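/- Let $f(\mathbf z,\bar{\mathbf z})=\sum_{\nu,\mu}c_{\nu\mu}\mathbf z^{\nu}\bar{\mathbf z}^{\mu}$ be a mixed polynomial on $\mathbb C^n=\mathbb R^{2n}$. Put $V_\eta=f^{-1}(\eta)$ for $\eta\in\mathbb C$ and $V=V_0$; let $S_r$ and $B_r$ be the sphere and the closed ball of radius $r$ about $\mathbf 0$. A point $\mathbf p$ is a mixed singular point of the fiber through it if it is a critical point of $f:\mathbb R^{2n}\to\mathbb R^2$. We say that the nearby fibers are smooth in $B_r$ for $0<|\eta|\le\delta$ if no $V_\eta$ with $0<|\eta|\le\delta$ has a mixed singular point in $B_r$. We say that $f$ satisfies Thom's $a_f$-condition at $\mathbf 0$ if there is a Whitney regular stratification $\mathcal S$ of $\mathbb C^n$ (a locally finite partition into smooth submanifolds, any two of which satisfy Whitney's condition (b)) such that $V$ is a union of strata, together with numbers $r>0$ and $\delta>0$ such that the nearby fibers are smooth in $B_r$ for $0<|\eta|\le\delta$ and the following holds: if $\mathbf z^{(k)}\in B_r$ is a sequence with $0<|f(\mathbf z^{(k)})|\le\delta$ that converges to a point $\mathbf w\ne\mathbf 0$ of a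 stratum $M\subset V$, and if the tangent spaces $T_{\mathbf z^{(k)}}f^{-1}(f(\mathbf z^{(k)}))$ converge in the Grassmannian to a subspace $\tau$, then $T_{\mathbf w}M\subset\tau$. Assume that $f$ satisfies the $a_f$-condition at $\mathbf 0$ and that the nearby fibers are smooth in $B_r$ for $0<|\eta|\le\delta$, for some $r,\delta>0$. Then there exists $r_0>0$ such that for every $r_1$ with $0<r_1\le r_0$ there exists $\delta>0$ such that for every $\eta$ with $0<|\eta|\le\delta$ and every $r$ with $r_1\le r\le r_0$ the fiber $V_\eta$ intersects the sphere $S_r$ transversely; that is, every $\mathbf p\in V_\eta\cap S_r$ is a non-singular point of $V_\eta$ and $T_{\mathbf p}V_\eta+T_{\mathbf p}S_r=\mathbb R^{2n}$. -/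

import Mathlib

open Set Filter Topology
open scoped ContDiff

noncomputable section

namespace MixedFunction

/-- `ℂⁿ` with its Hermitian norm. As a real vector space it is `ℝ²ⁿ` with the Euclidean inner
product `Re (z, w)`. -/
abbrev Cn (n : ℕ) : Type := EuclideanSpace ℂ (Fin n)

/-! ### Submanifolds, tangent spaces, limits of subspaces -/

/-- `M` is a smooth (embedded, locally closed) submanifold of `ℂⁿ = ℝ²ⁿ`: near each of its points
it is the zero set of a smooth submersion. Components may have different dimensions. -/
def IsSmoothSubmanifold {n : ℕ} (M : Set (Cn n)) : Prop :=
  ∀ p ∈ M, ∃ (k : ℕ) (U : Set (Cn n)) (g : Cn n → EuclideanSpace ℝ (Fin k)),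
    IsOpen U ∧ p ∈ U ∧ ContDiffOn ℝ ∞ g U ∧
      (∀ x ∈ U, Function.Surjective (fderiv ℝ g x)) ∧ M ∩ U = {x ∈ U | g x = 0}

/-- The real tangent space `T_p M`, spanned by the velocities at `p` of the curves in `M` through
`p`. (Where `M` is a submanifold the velocities already form a linear subspace.) -/
def tangentSpace {n : ℕ} (M : Set (Cn n)) (p : Cn n) : Submodule ℝ (Cn n) :=
  Submodule.span ℝ
    {v | ∃ γ : ℝ → Cn n, γ 0 = p ∧ (∀ᶠ t in 𝓝 (0 : ℝ), γ t ∈ M) ∧ HasDerivAt γ v 0}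

/-- Convergence `W k → τ` in the Grassmannian of real linear subspaces of `ℂⁿ`: the orthogonal
projections onto `W k` converge to the orthogonal projection onto `τ`. -/
def TendstoSubspace {n : ℕ} (W : ℕ → Submodule ℝ (Cn n)) (τ : Submodule ℝ (Cn n)) : Prop :=
  Tendsto (fun k => (W k).starProjection) atTop (𝓝 τ.starProjection)

/-! ### Whitney regular stratifications -/

/-- Whitney's condition (b) for the pair `(Y, X)` at every point of `X`; it implies Whitney's
condition (a). -/
def WhitneyRegular {n : ℕ} (Y X : Set (Cn n)) : Prop :=
  ∀ (x : Cn n) (xs ys : ℕ → Cn n) (l τ : Submodule ℝ (Cn n)),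
    x ∈ X → (∀ k, xs k ∈ X) → (∀ k, ys k ∈ Y) → (∀ k, xs k ≠ ys k) →
    Tendsto xs atTop (𝓝 x) → Tendsto ys atTop (𝓝 x) →
    TendstoSubspace (fun k => Submodule.span ℝ {ys k - xs k}) l →
    TendstoSubspace (fun k => tangentSpace Y (ys k)) τ → l ≤ τ

/-- `S` is a Whitney regular stratification of `ℂⁿ`: a locally finite partition into smooth
submanifolds (the strata), any two of which satisfy Whitney's regularity condition. -/
structure IsWhitneyStratification {n : ℕ} (S : Set (Set (Cn n))) : Prop where
  isPartition : Setoid.IsPartition S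
  locallyFinite : LocallyFinite (fun M : S => (M : Set (Cn n)))
  smooth : ∀ M ∈ S, IsSmoothSubmanifold M
  whitney : ∀ Y ∈ S, ∀ X ∈ S, Y ≠ X → WhitneyRegular Y X

/-! ### Mixed polynomials -/

/-- The function `z ↦ ∑ c_{νμ} z^ν z̄^μ` on `ℂⁿ` given by a polynomial `F = ∑ c_{νμ} u^ν v^μ` in
`2n` variables; the left variables are the `u_j`, the right ones the `v_j`. -/
def mixedPolynomial {n : ℕ} (F : MvPolynomial (Fin n ⊕ Fin n) ℂ) (z : Cn n) : ℂ :=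
  MvPolynomial.eval (Sum.elim (fun j => z j) (fun j => (starRingEnd ℂ) (z j))) F

/-- The fiber `V_η = f⁻¹(η)`. -/
def fiber {n : ℕ} (f : Cn n → ℂ) (η : ℂ) : Set (Cn n) := {z | f z = η}

/-- `p` is a mixed singular point of the fiber of `f` through `p`: a critical point of
`f : ℝ²ⁿ → ℝ²`, i.e. the real differential of `f` at `p` is not onto. -/
def IsMixedSingular {n : ℕ} (f : Cn n → ℂ) (p : Cn n) : Prop :=
  ¬ Function.Surjective (fderiv ℝ f p)

/-- All fibers `V_η` with `0 < |η| ≤ δ` are smooth in the ball `B_r`. -/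
def NearbyFibersSmooth {n : ℕ} (f : Cn n → ℂ) (r δ : ℝ) : Prop :=
  ∀ η : ℂ, 0 < ‖η‖ → ‖η‖ ≤ δ →
    ∀ z ∈ fiber f η ∩ Metric.closedBall 0 r, ¬ IsMixedSingular f z

/-- Thom's `a_f`-condition for `f` with respect to `S`, locally at the origin. The sequences run
through the nearby fibers in a small ball and converge to a point `w ≠ 0` of a stratum `M ⊆ V_0`. -/
def ThomCondition {n : ℕ} (f : Cn n → ℂ) (S : Set (Set (Cn n))) : Prop :=
  ∃ r > 0, ∃ δ > 0, NearbyFibersSmooth f r δ ∧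
    ∀ M ∈ S, M ⊆ fiber f 0 → ∀ w ∈ M, w ≠ 0 →
      ∀ (z : ℕ → Cn n) (τ : Submodule ℝ (Cn n)),
        (∀ k, z k ∈ Metric.closedBall 0 r) → (∀ k, 0 < ‖f (z k)‖ ∧ ‖f (z k)‖ ≤ δ) →
        Tendsto z atTop (𝓝 w) →
        TendstoSubspace (fun k => tangentSpace (fiber f (f (z k))) (z k)) τ →
        tangentSpace M w ≤ τ

/-- `f` satisfies the `a_f`-condition at the origin: it does so with respect to some Whitney
regular stratification of `ℂⁿ` for which `V_0 = f⁻¹(0)` is a union of strata. -/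
def SatisfiesThomCondition {n : ℕ} (f : Cn n → ℂ) : Prop :=
  ∃ S : Set (Set (Cn n)), IsWhitneyStratification S ∧
    (∃ T ⊆ S, fiber f 0 = ⋃₀ T) ∧ ThomCondition f S

/-- `V_η` meets the sphere `S_r` of radius `r` about the origin transversely: at every common point
`p`, the fiber is smooth and `T_p V_η + T_p S_r = ℝ²ⁿ`. -/
def MeetsSphereTransversely {n : ℕ} (f : Cn n → ℂ) (η : ℂ) (r : ℝ) : Prop :=
  ∀ p ∈ fiber f η ∩ Metric.sphere 0 r, ¬ IsMixedSingular f p ∧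
    tangentSpace (fiber f η) p ⊔ tangentSpace (Metric.sphere 0 r) p = ⊤

end MixedFunction

end

/-!
If transversality fails at a point `p` of a nearby fiber, then the position vector `p` is normal to
that fiber. If this happened at nearby fibers arbitrarily close to a point `w ≠ 0` of a stratum
`M ⊆ V_0`, a limit `τ` of the tangent spaces would be orthogonal to `w` and contain `T_w M` by
Thom's condition, so `w` would be normal to `M`. This is impossible for small `w`, since small
spheres are transverse to every stratum: for the stratum through the origin because the secants from
the origin are asymptotically tangent to it, for the other strata because, by Whitney's condition
(b), limits of these secants lie in the corresponding limits of tangent spaces. Hence transversality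
holds near every point of the compact set `{z ∈ V_0 | r₁ ≤ ‖z‖ ≤ r₀}`, and so on all sufficiently
nearby fibers.
-/

section SubspaceLimits

variable {ι 𝕜 E : Type*} [RCLike 𝕜] [NormedAddCommGroup E] [InnerProductSpace 𝕜 E]

theorem isClosed_setOfPred_isStarProjection {A : Type*} [Mul A] [Star A] [TopologicalSpace A]
    [T2Space A] [ContinuousMul A] [ContinuousStar A] : IsClosed {a : A | IsStarProjection a} := by
  simp only [isStarProjection_iff, IsIdempotentElem, IsSelfAdjoint, ofPred_and]
  exact (isClosed_eq (by fun_prop) continuous_id).inter (isClosed_eq continuous_star continuous_id)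

/-- The Grassmannian of all subspaces is compact, as the set of star projections is closed and
bounded. -/
theorem exists_subseq_tendsto_starProjection [FiniteDimensional 𝕜 E] (W : ℕ → Submodule 𝕜 E) :
    ∃ (τ : Submodule 𝕜 E) (φ : ℕ → ℕ), StrictMono φ ∧
      Tendsto (fun k => (W (φ k)).starProjection) atTop (𝓝 τ.starProjection) := by
  have : CompleteSpace E := FiniteDimensional.complete 𝕜 E
  have : ProperSpace (E →L[𝕜] E) := FiniteDimensional.proper 𝕜 _
  obtain ⟨P, -, φ, hφ, hP⟩ := (isCompact_closedBall (0 : E →L[𝕜] E) 1).tendsto_subseq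
    (x := fun k => (W k).starProjection) fun k => by simpa using (W k).starProjection_norm_le
  have hP_proj : IsStarProjection P :=
    isClosed_setOfPred_isStarProjection.mem_of_tendsto hP (.of_forall fun _ => by simp)
  obtain ⟨_, hP_eq⟩ := isStarProjection_iff_eq_starProjection_range.1 hP_proj
  exact ⟨P.range, φ, hφ, hP_eq ▸ hP⟩

theorem continuousAt_starProjection_span_singleton {v : E} (hv : v ≠ 0) :
    ContinuousAt (fun u : E => (Submodule.span 𝕜 {u}).starProjection) v := by
  have h_eq (u : E) : (Submodule.span 𝕜 {u}).starProjection =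
      (((‖u‖ ^ 2 : ℝ) : 𝕜)⁻¹) • ContinuousLinearMap.smulRightL 𝕜 E E (innerSL 𝕜 u) u := by
    ext x
    simp [Submodule.starProjection_singleton, smul_smul, div_eq_inv_mul]
  simp only [h_eq]
  have h_ne : ((‖v‖ ^ 2 : ℝ) : 𝕜) ≠ 0 := by simpa using hv
  have h_norm : ContinuousAt (fun u : E => (((‖u‖ ^ 2 : ℝ) : 𝕜)⁻¹)) v :=
    (RCLike.continuous_ofReal.comp (by fun_prop)).continuousAt.inv₀ h_ne
  have h_smulRight : Continuous fun u : E => ContinuousLinearMap.smulRightL 𝕜 E E (innerSL 𝕜 u) u :=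
    (ContinuousLinearMap.smulRightL 𝕜 E E).continuous₂.comp
      ((innerSL 𝕜).continuous.prodMk continuous_id)
  exact h_norm.smul h_smulRight.continuousAt

theorem exists_subseq_tendsto_starProjection_span_singleton [FiniteDimensional 𝕜 E] {y : ℕ → E}
    (hy : ∀ k, y k ≠ 0) :
    ∃ (v : E) (c : ℕ → 𝕜) (φ : ℕ → ℕ), v ≠ 0 ∧ StrictMono φ ∧
      Tendsto (fun k => c k • y (φ k)) atTop (𝓝 v) ∧
      Tendsto (fun k => (Submodule.span 𝕜 {y (φ k)}).starProjection) atTop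
        (𝓝 (Submodule.span 𝕜 {v}).starProjection) := by
  have : ProperSpace E := FiniteDimensional.proper 𝕜 E
  let c : ℕ → 𝕜 := fun k => (‖y k‖ : 𝕜)⁻¹
  have hc_span (k : ℕ) : Submodule.span 𝕜 {c k • y k} = Submodule.span 𝕜 {y k} :=
    Submodule.span_singleton_smul_eq (by simpa [c] using hy k) _
  obtain ⟨v, hv, φ, hφ, hv_lim⟩ := (isCompact_sphere (0 : E) 1).tendsto_subseq
    (x := fun k => c k • y k) fun k => by simp [c, norm_smul_inv_norm (hy k)]
  have hv_ne : v ≠ 0 := ne_zero_of_mem_unit_sphere ⟨v, hv⟩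
  refine ⟨v, c ∘ φ, φ, hv_ne, hφ, hv_lim, ?_⟩
  simpa only [Function.comp_def, hc_span] using
    (continuousAt_starProjection_span_singleton (𝕜 := 𝕜) hv_ne).tendsto.comp hv_lim

theorem mem_orthogonal_of_tendsto {l : Filter ι} [l.NeBot] {W : ι → Submodule 𝕜 E}
    {τ : Submodule 𝕜 E} [∀ i, (W i).HasOrthogonalProjection] [τ.HasOrthogonalProjection]
    {u : ι → E} {v : E} (hW : Tendsto (fun i => (W i).starProjection) l (𝓝 τ.starProjection))
    (hu : Tendsto u l (𝓝 v)) (hmem : ∀ i, u i ∈ (W i)ᗮ) : v ∈ τᗮ := by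
  have h_eval : Continuous fun q : (E →L[𝕜] E) × E => q.1 q.2 := by fun_prop
  have hlim : Tendsto (fun i => (W i).starProjection (u i)) l (𝓝 (τ.starProjection v)) :=
    (h_eval.tendsto (τ.starProjection, v)).comp (hW.prodMk_nhds hu)
  simp only [(Submodule.starProjection_apply_eq_zero_iff _).2 (hmem _)] at hlim
  exact (Submodule.starProjection_apply_eq_zero_iff _).1 <|
    tendsto_nhds_unique hlim tendsto_const_nhds

theorem isCoatom_orthogonal_span_singleton {p : E} (hp : p ≠ 0) :
    IsCoatom (Submodule.span 𝕜 {p})ᗮ := by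
  have h_ker : (Submodule.span 𝕜 {p})ᗮ = (innerSL 𝕜 p).toLinearMap.ker := by
    ext v
    simp [Submodule.mem_orthogonal_singleton_iff_inner_right]
  rw [h_ker]
  refine LinearMap.isCoatom_ker_of_surjective (LinearMap.surjective fun h => hp ?_)
  simpa using DFunLike.congr_fun h p

end SubspaceLimits

section Submersions

theorem norm_le_norm_of_mem_orthogonal_ker {𝕜 E F : Type*} [RCLike 𝕜] [NormedAddCommGroup E]
    [InnerProductSpace 𝕜 E] [AddCommGroup F] [Module 𝕜 F] {A : E →ₗ[𝕜] F} {v x : E}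
    (hv : v ∈ A.kerᗮ) (hx : A x = A v) : ‖v‖ ≤ ‖x‖ := by
  have h_orth : inner 𝕜 v (x - v) = 0 := A.ker.inner_left_of_mem_orthogonal (by simp [hx]) hv
  have h_pyth := norm_add_sq_eq_norm_sq_add_norm_sq_of_inner_eq_zero v (x - v) h_orth
  rw [add_sub_cancel] at h_pyth
  nlinarith [norm_nonneg x, norm_nonneg v, mul_self_nonneg ‖x - v‖]

theorem exists_eventually_exists_preimage_norm_le {𝕜 E F : Type*} [NontriviallyNormedField 𝕜]
    [NormedAddCommGroup E] [NormedSpace 𝕜 E] [CompleteSpace E]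
    [NormedAddCommGroup F] [NormedSpace 𝕜 F] [CompleteSpace F]
    {A₀ : E →L[𝕜] F} (hA₀ : Function.Surjective A₀) :
    ∃ C > 0, ∀ᶠ A in 𝓝 A₀, ∀ y, ∃ x, A x = y ∧ ‖x‖ ≤ C * ‖y‖ := by
  let R := A₀.nonlinearRightInverseOfSurjective (LinearMap.range_eq_top.2 hA₀)
  have hR : 0 < (R.nnnorm : ℝ) := A₀.nonlinearRightInverseOfSurjective_nnnorm_pos _
  refine ⟨2 * R.nnnorm, by positivity, ?_⟩
  filter_upwards [Metric.ball_mem_nhds A₀ (by positivity : 0 < (2 * R.nnnorm : ℝ)⁻¹)] with A hA y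
  have h_approx : ApproximatesLinearOn A A₀ univ ‖A - A₀‖₊ := fun x _ x' _ => by
    simpa using (A - A₀).le_opNorm (x - x')
  have h_close : ‖A - A₀‖ ≤ (2 * R.nnnorm : ℝ)⁻¹ := (mem_ball_iff_norm.1 hA).le
  obtain ⟨x, hx, hAx⟩ := h_approx.surjOn_closedBall_of_nonlinearRightInverse R
    (ε := 2 * R.nnnorm * ‖y‖) (b := 0) (by positivity) (subset_univ _) (a := y) (by
      rw [map_zero, mem_closedBall_zero_iff, coe_nnnorm]
      calc ‖y‖ = ((R.nnnorm : ℝ)⁻¹ - (2 * R.nnnorm : ℝ)⁻¹) * (2 * R.nnnorm * ‖y‖) := by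
            field_simp; ring
        _ ≤ _ := by gcongr)
  exact ⟨x, hAx, by simpa using hx⟩

theorem isLittleO_sub_fderiv_of_contDiffAt {𝕜 E F : Type*} [NontriviallyNormedField 𝕜]
    [NormedAddCommGroup E] [NormedSpace 𝕜 E] [NormedAddCommGroup F] [NormedSpace 𝕜 F]
    {g : E → F} {p : E} (hg : ContDiffAt 𝕜 1 g p) :
    (fun w => g w - g p - fderiv 𝕜 g w (w - p)) =o[𝓝 p] fun w => w - p := by
  have h_diff : (fun w => g w - g p - fderiv 𝕜 g p (w - p)) =o[𝓝 p] fun w => w - p :=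
    (hg.differentiableAt one_ne_zero).hasFDerivAt.isLittleO
  have h_apply : (fun w => (fderiv 𝕜 g w - fderiv 𝕜 g p) (w - p)) =o[𝓝 p] fun w => w - p := by
    refine Asymptotics.isLittleO_iff.2 fun c hc => ?_
    filter_upwards [(hg.continuousAt_fderiv one_ne_zero).eventually
      (Metric.closedBall_mem_nhds _ hc)] with w hw
    exact (fderiv 𝕜 g w - fderiv 𝕜 g p).le_of_opNorm_le (mem_closedBall_iff_norm.1 hw) _
  refine (h_diff.sub h_apply).congr_left fun w => ?_
  simp

/-- The secant from `p` to a nearby point `w` of the level set is almost tangent at `w`, so it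
cannot be normal there. -/
theorem eventually_eq_of_sub_mem_orthogonal_ker_fderiv {𝕜 E F : Type*} [RCLike 𝕜]
    [NormedAddCommGroup E] [InnerProductSpace 𝕜 E] [CompleteSpace E]
    [NormedAddCommGroup F] [NormedSpace 𝕜 F] [CompleteSpace F]
    {g : E → F} {p : E} (hg : ContDiffAt 𝕜 1 g p) (hsurj : Function.Surjective (fderiv 𝕜 g p)) :
    ∀ᶠ w in 𝓝 p, g w = g p → w - p ∈ (fderiv 𝕜 g w).kerᗮ → w = p := by
  obtain ⟨C, hC, h_preimage⟩ := exists_eventually_exists_preimage_norm_le hsurj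
  have h_bound := (isLittleO_sub_fderiv_of_contDiffAt hg).bound (by positivity : 0 < (2 * C)⁻¹)
  filter_upwards [(hg.continuousAt_fderiv one_ne_zero).eventually h_preimage, h_bound]
    with w h_preimage_w h_bound_w hgw horth
  obtain ⟨x, hx, hx_norm⟩ := h_preimage_w (fderiv 𝕜 g w (w - p))
  rw [hgw, sub_self, zero_sub, norm_neg] at h_bound_w
  have h_half : ‖w - p‖ ≤ ‖w - p‖ / 2 :=
    calc ‖w - p‖ ≤ ‖x‖ := norm_le_norm_of_mem_orthogonal_ker horth hx
      _ ≤ C * ‖fderiv 𝕜 g w (w - p)‖ := hx_norm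
      _ ≤ C * ((2 * C)⁻¹ * ‖w - p‖) := by gcongr
      _ = ‖w - p‖ / 2 := by field_simp
  exact sub_eq_zero.1 (norm_le_zero_iff.1 (by linarith))

theorem exists_hasDerivAt_of_mem_ker {E F : Type*}
    [NormedAddCommGroup E] [NormedSpace ℝ E] [CompleteSpace E]
    [NormedAddCommGroup F] [NormedSpace ℝ F] [CompleteSpace F]
    {g : E → F} {g' : E →L[ℝ] F} {p v : E} (hg : HasStrictFDerivAt g g' p)
    (hsurj : Function.Surjective g') (hker : g'.ker.ClosedComplemented) (hv : v ∈ g'.ker) :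
    ∃ γ : ℝ → E, γ 0 = p ∧ (∀ᶠ t in 𝓝 0, g (γ t) = g p) ∧ HasDerivAt γ v 0 := by
  have hrange : g'.range = ⊤ := LinearMap.range_eq_top.2 hsurj
  let ψ := hg.implicitFunctionOfComplemented g g' hrange hker (g p)
  let line : ℝ →L[ℝ] g'.ker := .toSpanSingleton ℝ ⟨v, hv⟩
  have hline : HasDerivAt line ⟨v, hv⟩ 0 := by
    simpa [line] using line.hasDerivAt (x := 0)
  have hline₀ : line 0 = 0 := map_zero line
  have hψ : HasFDerivAt ψ g'.ker.subtypeL (line 0) :=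
    hline₀ ▸ (hg.to_implicitFunctionOfComplemented hrange hker).hasFDerivAt
  have hline_lim : Tendsto (fun t => (g p, line t)) (𝓝 0) (𝓝 (g p, 0)) :=
    tendsto_const_nhds.prodMk_nhds (hline₀ ▸ hline.continuousAt.tendsto)
  refine ⟨ψ ∘ line, ?_, ?_, hψ.comp_hasDerivAt 0 hline⟩
  · rw [Function.comp_apply, hline₀]
    exact hg.implicitFunctionOfComplemented_apply_image hrange hker
  · exact hline_lim.eventually (hg.map_implicitFunctionOfComplemented_eq hrange hker)

end Submersions

theorem exists_forall_norm_lt_of_eventually {X F : Type*} [TopologicalSpace X]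
    [SeminormedAddGroup F] {K : Set X} (hK : IsCompact K) {f : X → F} (hf : ContinuousOn f K)
    {P : X → Prop} (hP : ∀ w ∈ K, ‖f w‖ = 0 → ∀ᶠ z in 𝓝 w, P z) :
    ∃ ε > 0, ∀ z ∈ K, ‖f z‖ < ε → P z := by
  have h_pos : ∀ z ∈ K \ interior {z | P z}, 0 < ‖f z‖ := fun z hz =>
    (norm_nonneg _).lt_of_ne' fun hfz => hz.2 (mem_interior_iff_mem_nhds.2 (hP z hz.1 hfz))
  obtain ⟨ε, hε, h_le⟩ :=
    (hK.diff isOpen_interior).exists_forall_le' (hf.mono sdiff_subset).norm h_pos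
  refine ⟨ε, hε, fun z hz hfz => ?_⟩
  by_contra hPz
  exact hfz.not_ge (h_le z ⟨hz, fun h => hPz (interior_subset h)⟩)

namespace MixedFunction

variable {n : ℕ}

section TangentSpaces

theorem ker_le_tangentSpace {F : Type*} [NormedAddCommGroup F] [NormedSpace ℝ F] [CompleteSpace F]
    {M : Set (Cn n)} {g : Cn n → F} {g' : Cn n →L[ℝ] F} {p : Cn n} (hg : HasStrictFDerivAt g g' p)
    (hsurj : Function.Surjective g') (hM : ∀ᶠ x in 𝓝 p, g x = g p → x ∈ M) :
    g'.ker ≤ tangentSpace M p := by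
  intro v hv
  obtain ⟨γ, hγ₀, hγ_level, hγ_deriv⟩ := exists_hasDerivAt_of_mem_ker hg hsurj
    (.of_finiteDimensional_quotient g'.isClosed_ker) hv
  have hγ_lim : Tendsto γ (𝓝 0) (𝓝 p) := hγ₀ ▸ hγ_deriv.continuousAt.tendsto
  refine Submodule.subset_span ⟨γ, hγ₀, ?_, hγ_deriv⟩
  filter_upwards [hγ_level, hγ_lim.eventually hM] with t ht htM using htM ht

theorem orthogonal_le_tangentSpace_sphere {p : Cn n} (hp : p ≠ 0) :
    (Submodule.span ℝ {p})ᗮ ≤ tangentSpace (Metric.sphere 0 ‖p‖) p := by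
  have h_surj : Function.Surjective (2 • innerSL ℝ p : Cn n →L[ℝ] ℝ) := by
    refine LinearMap.surjective (f := (2 • innerSL ℝ p : Cn n →L[ℝ] ℝ).toLinearMap) fun h => hp ?_
    simpa using DFunLike.congr_fun h p
  refine le_trans (fun v hv => ?_)
    (ker_le_tangentSpace (hasStrictFDerivAt_norm_sq p) h_surj (.of_forall fun x hx => ?_))
  · rw [Submodule.mem_orthogonal_singleton_iff_inner_right] at hv
    simp [LinearMap.mem_ker, hv]
  · simpa using hx

/-- The position vector of `p` is normal to `M` at `p`, that is, `T_p M` is contained in the tangent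
space of the sphere about the origin through `p`; for a submanifold `M` this is the failure of
transversality to that sphere. -/
def IsTangentToSphere (M : Set (Cn n)) (p : Cn n) : Prop :=
  p ∈ (tangentSpace M p)ᗮ

theorem tangentSpace_sup_tangentSpace_sphere_eq_top {M : Set (Cn n)} {p : Cn n} (hp : p ≠ 0)
    (hM : ¬ IsTangentToSphere M p) :
    tangentSpace M p ⊔ tangentSpace (Metric.sphere 0 ‖p‖) p = ⊤ := by
  have h_not_le : ¬ tangentSpace M p ≤ (Submodule.span ℝ {p})ᗮ := by
    rwa [Submodule.le_orthogonal_iff_le_orthogonal, Submodule.span_singleton_le_iff_mem]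
  have h_codisjoint := (isCoatom_orthogonal_span_singleton hp).not_le_iff_codisjoint.1 h_not_le
  exact (h_codisjoint.symm.mono_right (orthogonal_le_tangentSpace_sphere hp)).eq_top

end TangentSpaces

section Stratifications

theorem IsSmoothSubmanifold.eventually_not_isTangentToSphere {M : Set (Cn n)}
    (hM : IsSmoothSubmanifold M) (h₀ : 0 ∈ M) :
    ∀ᶠ w in 𝓝[≠] 0, w ∈ M → ¬ IsTangentToSphere M w := by
  obtain ⟨k, U, g, hU, h₀U, hg, hsurj, hMU⟩ := hM 0 h₀
  have hg_at : ∀ x ∈ U, ContDiffAt ℝ 1 g x := fun x hx =>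
    (hg.contDiffAt (hU.mem_nhds hx)).of_le (by exact_mod_cast le_top)
  have h_mem_iff : ∀ x ∈ U, x ∈ M ↔ g x = 0 := fun x hx => by
    simpa [hx] using Set.ext_iff.1 hMU x
  have h_secant := eventually_eq_of_sub_mem_orthogonal_ker_fderiv (hg_at 0 h₀U) (hsurj 0 h₀U)
  filter_upwards [nhdsWithin_le_nhds (hU.mem_nhds h₀U), nhdsWithin_le_nhds h_secant,
    self_mem_nhdsWithin] with w hwU hw hw_ne hwM hw_tangent
  have hgw : g w = 0 := (h_mem_iff w hwU).1 hwM
  have h_ker : (fderiv ℝ g w).ker ≤ tangentSpace M w := by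
    refine ker_le_tangentSpace ((hg_at w hwU).hasStrictFDerivAt one_ne_zero) (hsurj w hwU) ?_
    filter_upwards [hU.mem_nhds hwU] with x hxU hgx using (h_mem_iff x hxU).2 (hgx.trans hgw)
  refine hw_ne (hw (hgw.trans ((h_mem_iff 0 h₀U).1 h₀).symm) ?_)
  rw [sub_zero]
  exact Submodule.orthogonal_le h_ker hw_tangent

theorem WhitneyRegular.eventually_not_isTangentToSphere {Y X : Set (Cn n)}
    (hYX : WhitneyRegular Y X) (h₀ : 0 ∈ X) :
    ∀ᶠ w in 𝓝[≠] 0, w ∈ Y → ¬ IsTangentToSphere Y w := by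
  by_contra h_freq
  simp only [not_eventually, Classical.not_imp, not_not] at h_freq
  obtain ⟨y, hy_lim, hy⟩ := exists_seq_forall_of_frequently
    (h_freq.and_eventually self_mem_nhdsWithin)
  obtain ⟨v, c, φ, hv, hφ, hv_lim, h_secant⟩ :=
    exists_subseq_tendsto_starProjection_span_singleton (𝕜 := ℝ) fun k => (hy k).2
  obtain ⟨τ, ψ, hψ, hτ⟩ := exists_subseq_tendsto_starProjection
    fun k => tangentSpace Y (y (φ k))
  have hψ_lim := hψ.tendsto_atTop
  have hv_mem : v ∈ τ := (Submodule.span_singleton_le_iff_mem v τ).1 <|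
    hYX 0 (fun _ => 0) (fun k => y (φ (ψ k))) _ τ h₀ (fun _ => h₀) (fun _ => (hy _).1.1)
      (fun _ => Ne.symm (hy _).2) tendsto_const_nhds
      ((tendsto_nhds_of_tendsto_nhdsWithin hy_lim).comp (hφ.comp hψ).tendsto_atTop)
      (by simpa only [sub_zero] using! h_secant.comp hψ_lim) hτ
  have hv_orth : v ∈ τᗮ := mem_orthogonal_of_tendsto hτ (hv_lim.comp hψ_lim) fun _ =>
    Submodule.smul_mem _ _ (hy _).1.2
  exact hv (Submodule.disjoint_def.1 τ.orthogonal_disjoint v hv_mem hv_orth)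

theorem IsWhitneyStratification.eventually_not_isTangentToSphere {S : Set (Set (Cn n))}
    (hS : IsWhitneyStratification S) :
    ∀ᶠ w in 𝓝[≠] 0, ∀ M ∈ S, w ∈ M → ¬ IsTangentToSphere M w := by
  obtain ⟨X, ⟨hX, h₀⟩, -⟩ := hS.isPartition.2 0
  obtain ⟨t, ht, h_finite⟩ := hS.locallyFinite 0
  have h_each (M : S) : ∀ᶠ w in 𝓝[≠] 0, w ∈ (M : Set (Cn n)) → ¬ IsTangentToSphere M.1 w := by
    rcases eq_or_ne M.1 X with hMX | hMX
    · exact (hS.smooth M M.2).eventually_not_isTangentToSphere (hMX ▸ h₀)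
    · exact (hS.whitney M M.2 X hX hMX).eventually_not_isTangentToSphere h₀
  filter_upwards [h_finite.eventually_all.2 fun M _ => h_each M, nhdsWithin_le_nhds ht]
    with w hw hwt M hM hwM
  exact hw ⟨M, hM⟩ ⟨w, hwM, hwt⟩ hwM

end Stratifications

section NearbyFibers

variable {f : Cn n → ℂ}

theorem NearbyFibersSmooth.mono {r r' δ : ℝ} (hf : NearbyFibersSmooth f r δ) (hr : r' ≤ r) :
    NearbyFibersSmooth f r' δ := fun η hη hηδ z hz =>
  hf η hη hηδ z ⟨hz.1, Metric.closedBall_subset_closedBall hr hz.2⟩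

theorem ThomCondition.exists_eventually_not_isTangentToSphere {S : Set (Set (Cn n))}
    (hf : ThomCondition f S) :
    ∃ r > 0, ∃ δ > 0, NearbyFibersSmooth f r δ ∧
      ∀ M ∈ S, M ⊆ fiber f 0 → ∀ w ∈ M, w ≠ 0 → ¬ IsTangentToSphere M w →
        ∀ᶠ z in 𝓝 w, z ∈ Metric.closedBall 0 r → 0 < ‖f z‖ → ‖f z‖ ≤ δ →
          ¬ IsTangentToSphere (fiber f (f z)) z := by
  obtain ⟨r, hr, δ, hδ, h_smooth, h_thom⟩ := hf
  refine ⟨r, hr, δ, hδ, h_smooth, fun M hM hMV w hwM hw_ne hw_tangent => ?_⟩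
  by_contra h_freq
  simp only [not_eventually, Classical.not_imp, not_not] at h_freq
  obtain ⟨z, hz_lim, hz⟩ := exists_seq_forall_of_frequently h_freq
  obtain ⟨τ, φ, hφ, hτ⟩ := exists_subseq_tendsto_starProjection
    fun k => tangentSpace (fiber f (f (z k))) (z k)
  have hzφ_lim : Tendsto (fun k => z (φ k)) atTop (𝓝 w) := hz_lim.comp hφ.tendsto_atTop
  have h_le : tangentSpace M w ≤ τ := h_thom M hM hMV w hwM hw_ne (fun k => z (φ k)) τ
    (fun k => (hz _).1) (fun k => ⟨(hz _).2.1, (hz _).2.2.1⟩) hzφ_lim hτ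
  have hw_orth : w ∈ τᗮ := mem_orthogonal_of_tendsto hτ hzφ_lim fun k => (hz _).2.2.2
  exact hw_tangent (Submodule.orthogonal_le h_le hw_orth)

theorem SatisfiesThomCondition.exists_eventually_not_isTangentToSphere
    (hf : SatisfiesThomCondition f) :
    ∃ r > 0, ∃ δ > 0, NearbyFibersSmooth f r δ ∧
      ∀ w ∈ Metric.closedBall 0 r, w ≠ 0 → f w = 0 →
        ∀ᶠ z in 𝓝 w, z ∈ Metric.closedBall 0 r → 0 < ‖f z‖ → ‖f z‖ ≤ δ →
          ¬ IsTangentToSphere (fiber f (f z)) z := by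
  obtain ⟨S, hS, ⟨T, hTS, hT⟩, h_thom⟩ := hf
  obtain ⟨r, hr, δ, hδ, h_smooth, h_fibers⟩ := h_thom.exists_eventually_not_isTangentToSphere
  obtain ⟨ε, hε, h_strata⟩ := (nhdsWithin_hasBasis Metric.nhds_basis_closedBall _).eventually_iff.1
    hS.eventually_not_isTangentToSphere
  refine ⟨min r ε, lt_min hr hε, δ, hδ, h_smooth.mono (min_le_left _ _), fun w hw hw_ne hfw => ?_⟩
  obtain ⟨M, hMT, hwM⟩ : w ∈ ⋃₀ T := hT ▸ hfw
  have hMV : M ⊆ fiber f 0 := hT ▸ subset_sUnion_of_mem hMT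
  have hw_tangent : ¬ IsTangentToSphere M w :=
    h_strata ⟨Metric.closedBall_subset_closedBall (min_le_right _ _) hw, hw_ne⟩ M (hTS hMT) hwM
  filter_upwards [h_fibers M (hTS hMT) hMV w hwM hw_ne hw_tangent] with z hz hzr
  exact hz (Metric.closedBall_subset_closedBall (min_le_left _ _) hzr)

theorem continuous_mixedPolynomial (F : MvPolynomial (Fin n ⊕ Fin n) ℂ) :
    Continuous (mixedPolynomial F) := by
  refine F.continuous_eval.comp (continuous_pi ?_)
  rintro (j | j)
  · exact PiLp.continuous_apply 2 _ j
  · exact Complex.continuous_conj.comp (PiLp.continuous_apply 2 _ j)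

end NearbyFibers

end MixedFunction

open MixedFunction in
theorem mainTheorem6_general {n : ℕ} {f : Cn n → ℂ} (hf : Continuous f)
    (haf : SatisfiesThomCondition f) :
    ∃ r₀ : ℝ, 0 < r₀ ∧ ∀ r₁ : ℝ, 0 < r₁ → r₁ ≤ r₀ →
      ∃ δ : ℝ, 0 < δ ∧ ∀ η : ℂ, 0 < ‖η‖ → ‖η‖ ≤ δ → ∀ r : ℝ, r₁ ≤ r → r ≤ r₀ →
        MeetsSphereTransversely f η r := by
  obtain ⟨r₀, hr₀, δ₀, hδ₀, h_smooth, h_local⟩ := haf.exists_eventually_not_isTangentToSphere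
  refine ⟨r₀, hr₀, fun r₁ hr₁ _ => ?_⟩
  have h_shell : IsCompact (Metric.closedBall (0 : Cn n) r₀ \ Metric.ball 0 r₁) :=
    (isCompact_closedBall 0 r₀).diff Metric.isOpen_ball
  obtain ⟨ε, hε, h_uniform⟩ := exists_forall_norm_lt_of_eventually h_shell hf.continuousOn
    fun w hw hfw => h_local w hw.1 (by rintro rfl; exact hw.2 (Metric.mem_ball_self hr₁))
      (norm_eq_zero.1 hfw)
  refine ⟨min δ₀ (ε / 2), by positivity, ?_⟩
  rintro η hη hηδ r hr₁r hrr₀ p ⟨rfl, hp⟩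
  obtain rfl : ‖p‖ = r := mem_sphere_zero_iff_norm.1 hp
  have hp_ball : p ∈ Metric.closedBall 0 r₀ := mem_closedBall_zero_iff.2 hrr₀
  have hpδ : ‖f p‖ ≤ δ₀ := hηδ.trans (min_le_left _ _)
  have hpε : ‖f p‖ < ε := hηδ.trans_lt ((min_le_right _ _).trans_lt (half_lt_self hε))
  refine ⟨h_smooth _ hη hpδ p ⟨rfl, hp_ball⟩,
    tangentSpace_sup_tangentSpace_sphere_eq_top (norm_pos_iff.1 (hr₁.trans_le hr₁r)) ?_⟩
  exact h_uniform p ⟨hp_ball, by simpa using hr₁r⟩ hpε hp_ball hη hpδ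

theorem mainTheorem6 (n : ℕ) (F : MvPolynomial (Fin n ⊕ Fin n) ℂ)
    (haf : MixedFunction.SatisfiesThomCondition (MixedFunction.mixedPolynomial F))
    (hsmooth : ∃ r > 0, ∃ δ > 0,
      MixedFunction.NearbyFibersSmooth (MixedFunction.mixedPolynomial F) r δ) :
    ∃ r₀ : ℝ, 0 < r₀ ∧ ∀ r₁ : ℝ, 0 < r₁ → r₁ ≤ r₀ →
      ∃ δ : ℝ, 0 < δ ∧ ∀ η : ℂ, 0 < ‖η‖ → ‖η‖ ≤ δ → ∀ r : ℝ, r₁ ≤ r → r ≤ r₀ →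
        MixedFunction.MeetsSphereTransversely (MixedFunction.mixedPolynomial F) η r :=
  mainTheorem6_general (MixedFunction.continuous_mixedPolynomial F) haf
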